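/- A locale is a complete lattice in which binary meets distribute over arbitrary joins. A morphism of locales $f:X\to Y$ is a localic map, that is, a map $f:X\to Y$ preserving all meets whose left adjoint $f^*:Y\to X$ preserves finite meets (equivalently, it is given by the frame homomorphism $f^*$). A sublocale of $L$ is a subset $S\subseteq L$ closed under all meets and such that $x\Rightarrow s\in S$ for all $x\in L$, $s\in S$; it is a locale in the induced order. The image of a sublocale $S$ under a localic map $f$ is the sublocale $f(S)=\{f(s):s\in S\}$. The closed sublocales are those of the form $\uparrow a$, and a localic map is closed if the image of every closed sublocale is closed. A locale $L$ is strongly Hausdorff if the diagonal $L\to L\times L$ (product in the category of locales) is closed, and it is compact if every $A\subseteq L$ with $\bigvee A=1$ has a finite subset $F\subseteq A$ with $\bigvee F=1$. Let $\mathsf{HLoc}$ be the full subcategory of the category of locales on the strongly Hausdorff locales. Let $L$ be a strongly Hausdorff locale. Let $\mathcal K(L)$ be the set of sublocales of $L$ that are compact locales, ordered by inclusion and regarded as a small category, and let $\mathsf{KHLoc}/L$ be the full subcategory of the over category $\mathsf{HLoc}/L$ on the morphisms $\sigma:K\to L$ with $K$ compact and strongly Hausdorff. Every sublocale of $L$ is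 strongly Hausdorff, so there is a functor $U_L:\mathcal K(L)\to\mathsf{KHLoc}/L$ sending $K$ to its inclusion $i_K:K\to L$ and $K\subseteq K'$ to the inclusion $K\to K'$ over $L$. There is also a functor $R_L:\mathsf{KHLoc}/L\to\mathcal K(L)$ sending $\sigma:K\to L$ to its image $\sigma(K)$. **Proposition.** The functor $U_L$ is fully faithful and has $R_L$ as a left adjoint, so that $\mathcal K(L)$ is a reflective subcategory of $\mathsf{KHLoc}/L$ with reflection $\sigma\mapsto\sigma(K)$. The functor $U_L$ is final: for every object $\sigma$ of $\mathsf{KHLoc}/L$ the slice category $\sigma/U_L$ is connected. In particular, $\mathsf{KHLoc}/L$ is finally small, i.e. it admits a final functor from a small category. -/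

import Mathlib

open CategoryTheory CategoryTheory.Limits

universe u

namespace Locale

/-! ## Locales, localic maps, images of sublocales -/

/-- The frame homomorphism `f^* : Y → X` underlying a morphism `f : X ⟶ Y` of locales. -/
def inverseImage {X Y : Locale.{u}} (f : X ⟶ Y) : FrameHom Y X := f.unop.hom

/-- The morphism of locales `X ⟶ Y` given by a frame homomorphism `Y → X`. -/
def homOfFrameHom {X Y : Locale.{u}} (h : FrameHom Y X) : X ⟶ Y :=
  Opposite.op (Frm.ofHom h : Y.unop ⟶ X.unop)

/-- The localic map `f_* : X → Y` of a morphism of locales `f : X ⟶ Y`: the right adjoint of the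
frame homomorphism `f^*`. -/
def localicMap {X Y : Locale.{u}} (f : X ⟶ Y) (x : X) : Y := sSup {y | inverseImage f y ≤ x}

theorem inverseImage_homOfFrameHom {X Y : Locale.{u}} (h : FrameHom Y X) :
    inverseImage (homOfFrameHom h) = h := rfl

theorem inverseImage_comp {X Y Z : Locale.{u}} (f : X ⟶ Y) (g : Y ⟶ Z) (z : Z) :
    inverseImage (f ≫ g) z = inverseImage f (inverseImage g z) := rfl

theorem inverseImage_id (X : Locale.{u}) (x : X) : inverseImage (𝟙 X) x = x := rfl

theorem hom_ext' {X Y : Locale.{u}} {f g : X ⟶ Y}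
    (h : ∀ y, inverseImage f y = inverseImage g y) : f = g :=
  Quiver.Hom.unop_inj (Frm.ext h)

theorem gc {X Y : Locale.{u}} (f : X ⟶ Y) :
    GaloisConnection (inverseImage f) (localicMap f) := fun y x =>
  ⟨fun h => le_sSup h, fun h => ((OrderHomClass.mono (inverseImage f)) h).trans <| by
    unfold localicMap
    rw [map_sSup]
    exact sSup_le (by rintro _ ⟨z, hz, rfl⟩; exact hz)⟩

theorem localicMap_comp {X Y Z : Locale.{u}} (f : X ⟶ Y) (g : Y ⟶ Z) (x : X) :
    localicMap (f ≫ g) x = localicMap g (localicMap f x) :=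
  eq_of_forall_le_iff fun z => by
    rw [← (gc (f ≫ g)).le_iff_le, ← (gc g).le_iff_le, ← (gc f).le_iff_le, inverseImage_comp]

theorem himp_localicMap {X Y : Locale.{u}} (f : X ⟶ Y) (y : Y) (x : X) :
    y ⇨ localicMap f x = localicMap f (inverseImage f y ⇨ x) :=
  eq_of_forall_le_iff fun z => by
    rw [le_himp_iff, ← (gc f).le_iff_le, ← (gc f).le_iff_le, le_himp_iff, map_inf]

/-- The image `f(S) = {f_*(s) : s ∈ S}` of a sublocale `S` under a localic map. -/
def image {X Y : Locale.{u}} (f : X ⟶ Y) (S : Sublocale X) : Sublocale Y where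
  carrier := localicMap f '' S
  sInf_mem' A hA := by
    refine ⟨sInf {s | s ∈ S ∧ localicMap f s ∈ A}, S.sInf_mem fun s hs => hs.1, ?_⟩
    rw [(gc f).u_sInf]
    refine le_antisymm (le_sInf fun a ha => ?_) (le_iInf₂ fun s hs => sInf_le hs.2)
    obtain ⟨s, hs, rfl⟩ := hA ha
    exact iInf₂_le s ⟨hs, ha⟩
  himp_mem' y _ := by
    rintro ⟨s, hs, rfl⟩
    exact ⟨inverseImage f y ⇨ s, S.himp_mem hs, (himp_localicMap f y s).symm⟩

/-- The image `f(X)` of the whole locale `X` under a localic map `f : X ⟶ Y`. -/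
def range {X Y : Locale.{u}} (f : X ⟶ Y) : Sublocale Y := image f ⊤

/-- The closed sublocale `𝔠(a) = ↑a`. -/
def closedSublocale {X : Locale.{u}} (a : X) : Sublocale X where
  carrier := Set.Ici a
  sInf_mem' _ hA := le_sInf hA
  himp_mem' _ _ hb := le_trans hb le_himp

/-- A morphism of locales is closed if the image of every closed sublocale is closed. -/
def IsClosedMap {X Y : Locale.{u}} (f : X ⟶ Y) : Prop :=
  ∀ a : X, ∃ b : Y, image f (closedSublocale a) = closedSublocale b

theorem mem_top {X : Locale.{u}} (x : X) : x ∈ (⊤ : Sublocale X) :=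
  (le_top : (⟨Set.univ, fun _ _ => trivial, fun _ _ _ => trivial⟩ : Sublocale X) ≤ ⊤) trivial

theorem mem_range {X Y : Locale.{u}} {f : X ⟶ Y} {y : Y} :
    y ∈ range f ↔ ∃ x, localicMap f x = y :=
  ⟨fun ⟨x, _, h⟩ => ⟨x, h⟩, fun ⟨x, h⟩ => ⟨x, mem_top x, h⟩⟩

/-! ## Sublocales as locales -/

/-- The inclusion `i_S : S ⟶ L` of a sublocale, as a morphism of locales. -/
def incl {L : Locale.{u}} (S : Sublocale L) : of S ⟶ L :=
  homOfFrameHom (X := of S) S.restrict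

/-- The localic map of `incl S` is the inclusion of the subset `S`. -/
theorem localicMap_incl {L : Locale.{u}} (S : Sublocale L) (s : S) :
    localicMap (incl S) s = (s : L) :=
  (gc (incl S)).u_unique S.giRestrict.gc (fun _ => rfl)

theorem range_incl {L : Locale.{u}} (S : Sublocale L) : range (incl S) = S := by
  ext y
  rw [mem_range]
  constructor
  · rintro ⟨x, rfl⟩
    have h : localicMap (incl S) x ∈ S ↔ _ ∈ S := iff_of_eq (congrArg (· ∈ S) (localicMap_incl S x))
    exact h.2 (Subtype.property (p := (· ∈ S)) x)
  · exact fun h => ⟨⟨y, h⟩, localicMap_incl S ⟨y, h⟩⟩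

theorem inclOfLE_gc {X : Type u} [Order.Frame X] {S T : Sublocale X} (h : S ≤ T) :
    GaloisConnection (fun t : T => S.restrict (t : X)) (fun s : S => (⟨s, h s.2⟩ : T)) :=
  fun t s => S.giRestrict.gc (t : X) s

/-- The frame homomorphism `T → S` of the inclusion of sublocales `S ⊆ T`. -/
def inclOfLEHom {X : Type u} [Order.Frame X] {S T : Sublocale X} (h : S ≤ T) : FrameHom T S where
  toFun t := S.restrict (t : X)
  map_inf' a b := by rw [Sublocale.coe_inf, map_inf]
  map_top' := map_top S.restrict
  map_sSup' _ := (inclOfLE_gc h).l_sSup.trans sSup_image.symm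

/-- The inclusion `S ⟶ T` of sublocales `S ⊆ T` of `L`, as a morphism of locales. -/
def inclOfLE {L : Locale.{u}} {S T : Sublocale L} (h : S ≤ T) : of S ⟶ of T :=
  homOfFrameHom (X := of S) (Y := of T) (inclOfLEHom h)

/-- The localic map of `inclOfLE` is the inclusion of subsets. -/
theorem localicMap_inclOfLE {L : Locale.{u}} {S T : Sublocale L} (h : S ≤ T) (s : S) :
    localicMap (inclOfLE h) s = (⟨s, h s.2⟩ : T) :=
  (gc (inclOfLE h)).u_unique (inclOfLE_gc h) (fun _ => rfl)

theorem inclOfLE_incl {L : Locale.{u}} {S T : Sublocale L} (h : S ≤ T) :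
    inclOfLE h ≫ incl T = incl S :=
  hom_ext' fun y => eq_of_forall_ge_iff fun s => by
    have e : localicMap (inclOfLE h ≫ incl T) s = localicMap (incl S) s :=
      (localicMap_comp _ _ s).trans <| (congrArg _ (localicMap_inclOfLE h s)).trans <|
        (localicMap_incl T _).trans (localicMap_incl S s).symm
    rw [(gc _).le_iff_le, (gc _).le_iff_le, e]

theorem mono_incl {L : Locale.{u}} (S : Sublocale L) : Mono (incl S) where
  right_cancellation {Z} g h e := hom_ext' fun (s : S) => by
    have hs : inverseImage (incl S) (s : L) = s := S.restrict_of_mem s.2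
    have := congrArg (fun k => inverseImage k (s : L)) e
    exact (congrArg (inverseImage g) hs).symm.trans (this.trans (congrArg (inverseImage h) hs))

theorem inclOfLE_refl {L : Locale.{u}} (S : Sublocale L) :
    inclOfLE (le_refl S) = 𝟙 (of S) := by
  have := mono_incl S
  rw [← cancel_mono (incl S), inclOfLE_incl, Category.id_comp]

theorem inclOfLE_comp {L : Locale.{u}} {S T U : Sublocale L} (h : S ≤ T) (k : T ≤ U) :
    inclOfLE h ≫ inclOfLE k = inclOfLE (h.trans k) := by
  have := mono_incl U
  rw [← cancel_mono (incl U), Category.assoc, inclOfLE_incl, inclOfLE_incl, inclOfLE_incl]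

/-! ## Binary products of locales -/

/-- The frame of the product locale `L × M`, as the sublocale of the frame of lower sets of
`L × M` formed by the lower sets that are closed under suprema in each variable. -/
def prodSublocale (L M : Locale.{u}) : Sublocale (LowerSet (L × M)) where
  carrier := {U | (∀ (A : Set L) (b : M), (∀ a ∈ A, (a, b) ∈ U) → (sSup A, b) ∈ U) ∧
    ∀ (a : L) (B : Set M), (∀ b ∈ B, (a, b) ∈ U) → (a, sSup B) ∈ U}
  sInf_mem' 𝒰 h𝒰 := by
    constructor
    · intro A b hA
      rw [LowerSet.mem_sInf_iff]
      exact fun U hU => (h𝒰 hU).1 A b fun a ha => LowerSet.mem_sInf_iff.1 (hA a ha) U hU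
    · intro a B hB
      rw [LowerSet.mem_sInf_iff]
      exact fun U hU => (h𝒰 hU).2 a B fun b hb => LowerSet.mem_sInf_iff.1 (hB b hb) U hU
  himp_mem' W U hU := by
    have key : ∀ p : L × M, p ∈ W ⇨ U ↔ ∀ q ≤ p, q ∈ W → q ∈ U := fun p => by
      rw [← LowerSet.Iic_le, le_himp_iff]
      exact ⟨fun h q hq hW => h ⟨hq, hW⟩, fun h q hq => h q hq.1 hq.2⟩
    constructor
    · intro A b hA
      rw [key]
      rintro ⟨x, y⟩ ⟨hx, hy⟩ hW
      have hx : x ≤ sSup A := hx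
      have : x = sSup ((fun a => x ⊓ a) '' A) := by
        rw [sSup_image, ← inf_sSup_eq, inf_eq_left.2 hx]
      rw [this]
      refine hU.1 _ _ ?_
      rintro _ ⟨a, ha, rfl⟩
      exact (key _).1 (hA a ha) (x ⊓ a, y) ⟨inf_le_right, hy⟩
        (W.lower (⟨inf_le_left, le_rfl⟩ : (x ⊓ a, y) ≤ (x, y)) hW)
    · intro a B hB
      rw [key]
      rintro ⟨x, y⟩ ⟨hx, hy⟩ hW
      have hy : y ≤ sSup B := hy
      have : y = sSup ((fun b => y ⊓ b) '' B) := by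
        rw [sSup_image, ← inf_sSup_eq, inf_eq_left.2 hy]
      rw [this]
      refine hU.2 _ _ ?_
      rintro _ ⟨b, hb, rfl⟩
      exact (key _).1 (hB b hb) (x, y ⊓ b) ⟨hx, inf_le_right⟩
        (W.lower (⟨le_rfl, inf_le_left⟩ : (x, y ⊓ b) ≤ (x, y)) hW)

/-- The product locale. -/
def prodLocale (L M : Locale.{u}) : Locale.{u} := of (prodSublocale L M)

theorem prodRestrict_le_iff {L M : Locale.{u}} (p : L × M) (U : prodSublocale L M) :
    (prodSublocale L M).restrict (LowerSet.Iic p) ≤ U ↔ p ∈ (U : LowerSet (L × M)) := by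
  rw [(prodSublocale L M).giRestrict.gc.le_iff_le, LowerSet.Iic_le]

/-- The frame homomorphism of the first projection. -/
def prodFstHom (L M : Locale.{u}) : FrameHom L (prodSublocale L M) where
  toFun a := (prodSublocale L M).restrict (LowerSet.Iic (a, ⊤))
  map_inf' a b := by
    rw [← map_inf]
    congr 1
    ext ⟨x, y⟩
    simp
  map_top' := by
    rw [← map_top (prodSublocale L M).restrict]
    congr 1
    ext ⟨x, y⟩
    simp
  map_sSup' A := eq_of_forall_ge_iff fun U => by
    rw [prodRestrict_le_iff, sSup_le_iff]
    simp only [Set.forall_mem_image, prodRestrict_le_iff]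
    exact ⟨fun h a ha => U.1.lower (Prod.mk_le_mk.2 ⟨le_sSup ha, le_rfl⟩) h,
      fun h => U.2.1 A ⊤ h⟩

/-- The frame homomorphism of the second projection. -/
def prodSndHom (L M : Locale.{u}) : FrameHom M (prodSublocale L M) where
  toFun b := (prodSublocale L M).restrict (LowerSet.Iic (⊤, b))
  map_inf' a b := by
    rw [← map_inf]
    congr 1
    ext ⟨x, y⟩
    simp
  map_top' := by
    rw [← map_top (prodSublocale L M).restrict]
    congr 1
    ext ⟨x, y⟩
    simp
  map_sSup' B := eq_of_forall_ge_iff fun U => by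
    rw [prodRestrict_le_iff, sSup_le_iff]
    simp only [Set.forall_mem_image, prodRestrict_le_iff]
    exact ⟨fun h b hb => U.1.lower (Prod.mk_le_mk.2 ⟨le_rfl, le_sSup hb⟩) h,
      fun h => U.2.2 ⊤ B h⟩

theorem prodFst_inf_prodSnd {L M : Locale.{u}} (p : L × M) :
    prodFstHom L M p.1 ⊓ prodSndHom L M p.2 =
      (prodSublocale L M).restrict (LowerSet.Iic p) := by
  change (prodSublocale L M).restrict _ ⊓ (prodSublocale L M).restrict _ = _
  rw [← map_inf]
  congr 1
  ext ⟨x, y⟩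
  simp [Prod.le_def]

/-- Every element of the frame of the product is a join of rectangles. -/
theorem prod_eq_iSup {L M : Locale.{u}} (U : prodSublocale L M) :
    U = ⨆ p ∈ (U : LowerSet (L × M)), prodFstHom L M p.1 ⊓ prodSndHom L M p.2 :=
  eq_of_forall_ge_iff fun V => by
    simp only [iSup_le_iff, prodFst_inf_prodSnd, prodRestrict_le_iff]
    exact ⟨fun h p hp => h hp, fun h p hp => h p hp⟩

/-- The right adjoint of the frame homomorphism `prodLiftHom`. -/
def prodLiftRight {L M : Locale.{u}} {X : Type u} [Order.Frame X] (f : FrameHom L X)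
    (g : FrameHom M X) (x : X) : prodSublocale L M :=
  ⟨⟨{p | f p.1 ⊓ g p.2 ≤ x}, fun p q h hp =>
      (inf_le_inf (OrderHomClass.mono f h.1) (OrderHomClass.mono g h.2)).trans hp⟩, by
    constructor
    · intro A b hA
      change f (sSup A) ⊓ g b ≤ x
      rw [map_sSup, sSup_inf_eq, iSup₂_le_iff]
      rintro _ ⟨a, ha, rfl⟩
      exact hA a ha
    · intro a B hB
      change f a ⊓ g (sSup B) ≤ x
      rw [map_sSup, inf_sSup_eq, iSup₂_le_iff]
      rintro _ ⟨b, hb, rfl⟩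
      exact hB b hb⟩

theorem prodLift_gc {L M : Locale.{u}} {X : Type u} [Order.Frame X] (f : FrameHom L X)
    (g : FrameHom M X) : GaloisConnection
      (fun U : prodSublocale L M => ⨆ p ∈ (U : LowerSet (L × M)), f p.1 ⊓ g p.2)
      (prodLiftRight f g) := fun U x => by
  rw [iSup₂_le_iff]
  exact ⟨fun h p hp => h p hp, fun h p hp => h hp⟩

/-- The frame homomorphism out of the frame of the product induced by a pair of frame
homomorphisms. -/
def prodLiftHom {L M : Locale.{u}} {X : Type u} [Order.Frame X] (f : FrameHom L X)
    (g : FrameHom M X) : FrameHom (prodSublocale L M) X where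
  toFun U := ⨆ p ∈ (U : LowerSet (L × M)), f p.1 ⊓ g p.2
  map_inf' U V := by
    refine le_antisymm (le_inf ((prodLift_gc f g).monotone_l inf_le_left)
      ((prodLift_gc f g).monotone_l inf_le_right)) ?_
    simp only [iSup_inf_eq, inf_iSup_eq, iSup_le_iff]
    intro p hp q hq
    refine le_iSup₂_of_le (p ⊓ q) ?_ ?_
    · exact ⟨U.1.lower inf_le_right hq, V.1.lower inf_le_left hp⟩
    · simp only [Prod.fst_inf, Prod.snd_inf, map_inf]
      refine le_of_eq ?_
      ac_rfl
  map_top' := top_le_iff.1 (le_iSup₂_of_le (⊤, ⊤) trivial (by simp))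
  map_sSup' 𝒰 := by rw [(prodLift_gc f g).l_sSup, sSup_image]

theorem prodLiftHom_fst {L M : Locale.{u}} {X : Type u} [Order.Frame X] (f : FrameHom L X)
    (g : FrameHom M X) (a : L) : prodLiftHom f g (prodFstHom L M a) = f a :=
  eq_of_forall_ge_iff fun x => by
    refine ((prodLift_gc f g).le_iff_le).trans ((prodRestrict_le_iff _ _).trans ?_)
    change f a ⊓ g ⊤ ≤ x ↔ _
    rw [map_top, inf_top_eq]

theorem prodLiftHom_snd {L M : Locale.{u}} {X : Type u} [Order.Frame X] (f : FrameHom L X)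
    (g : FrameHom M X) (b : M) : prodLiftHom f g (prodSndHom L M b) = g b :=
  eq_of_forall_ge_iff fun x => by
    refine ((prodLift_gc f g).le_iff_le).trans ((prodRestrict_le_iff _ _).trans ?_)
    change f ⊤ ⊓ g b ≤ x ↔ _
    rw [map_top, top_inf_eq]

/-- `prodLocale L M` with its projections. -/
def prodFan (L M : Locale.{u}) : BinaryFan L M :=
  BinaryFan.mk (P := prodLocale L M) (homOfFrameHom (X := prodLocale L M) (prodFstHom L M))
    (homOfFrameHom (X := prodLocale L M) (prodSndHom L M))

/-- `prodLocale L M` is the product of `L` and `M` in the category of locales. -/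
def prodFanIsLimit (L M : Locale.{u}) : IsLimit (prodFan L M) :=
  BinaryFan.isLimitMk
    (fun s => homOfFrameHom (Y := prodLocale L M)
      (prodLiftHom (inverseImage s.fst) (inverseImage s.snd)))
    (fun s => hom_ext' fun a => prodLiftHom_fst (inverseImage s.fst) (inverseImage s.snd) a)
    (fun s => hom_ext' fun b => prodLiftHom_snd (inverseImage s.fst) (inverseImage s.snd) b)
    (fun s m h₁ h₂ => hom_ext' fun U => by
      have e₁ : ∀ a, inverseImage m (prodFstHom L M a) = inverseImage s.fst a :=
        fun a => congrArg (fun k => inverseImage k a) h₁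
      have e₂ : ∀ b, inverseImage m (prodSndHom L M b) = inverseImage s.snd b :=
        fun b => congrArg (fun k => inverseImage k b) h₂
      have e₃ : inverseImage m U = inverseImage m
          (⨆ p ∈ (U.1 : LowerSet (L × M)), prodFstHom L M p.1 ⊓ prodSndHom L M p.2) :=
        congrArg (inverseImage m) (prod_eq_iSup U)
      refine e₃.trans ((map_iSup₂ (inverseImage m) _).trans ?_)
      refine iSup_congr fun p => iSup_congr fun _ => ?_
      exact (map_inf (inverseImage m) _ _).trans (congrArg₂ (· ⊓ ·) (e₁ p.1) (e₂ p.2)))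

instance hasBinaryProducts : HasBinaryProducts Locale.{u} :=
  have (L M : Locale.{u}) : HasLimit (pair L M) := ⟨⟨⟨prodFan L M, prodFanIsLimit L M⟩⟩⟩
  hasBinaryProducts_of_hasLimit_pair _

/-! ## Strongly Hausdorff locales and compact locales -/

/-- A locale `L` is strongly Hausdorff if its diagonal `L ⟶ L × L` is a closed map. -/
def IsStronglyHausdorff : ObjectProperty Locale.{u} := fun L => IsClosedMap (diag L)

/-- A locale is compact if every cover has a finite subcover. -/
def IsCompactLocale : ObjectProperty Locale.{u} := fun L =>
  ∀ A : Set L, sSup A = ⊤ → ∃ F ⊆ A, F.Finite ∧ sSup F = ⊤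

theorem isStronglyHausdorff_of_sublocale {L : Locale.{u}} (hL : IsStronglyHausdorff L)
    (S : Sublocale L) : IsStronglyHausdorff (of S) := by
  obtain ⟨d, hd⟩ := hL ⊥
  have hd' : ∀ y, d ≤ y → localicMap (diag L) (inverseImage (diag L) y) = y := fun y hy => by
    have : y ∈ image (diag L) (closedSublocale ⊥) := hd ▸ hy
    obtain ⟨x, -, rfl⟩ := this
    exact (gc (diag L)).u_l_u_eq_u x
  have hdiag : inverseImage (diag L) d = ⊥ := by
    have : localicMap (diag L) ⊥ ∈ image (diag L) (closedSublocale ⊥) := ⟨⊥, le_rfl, rfl⟩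
    rw [hd] at this
    exact le_bot_iff.1 ((gc (diag L)).l_le this)
  -- A map into `L × L` whose inverse image kills `d` equalizes the projections.
  have key : ∀ {Z : Locale.{u}} (h : Z ⟶ L ⨯ L), inverseImage h d = ⊥ →
      h ≫ prod.fst = h ≫ prod.snd := fun {Z} h hh => hom_ext' fun a => by
    have aux : ∀ y, inverseImage h y =
        inverseImage h (localicMap (diag L) (inverseImage (diag L) y)) := fun y => by
      have hle : d ≤ localicMap h (inverseImage h y) := (gc h).le_u (hh ▸ bot_le)
      refine le_antisymm (OrderHomClass.mono _ ((gc (diag L)).le_u_l y)) ((gc h).l_le ?_)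
      rw [← hd' _ hle]
      exact (gc (diag L)).monotone_u
        (OrderHomClass.mono (inverseImage (diag L)) ((gc h).le_u_l y))
    have h₁ : inverseImage (diag L) (inverseImage (prod.fst : L ⨯ L ⟶ L) a) =
        inverseImage (diag L) (inverseImage (prod.snd : L ⨯ L ⟶ L) a) := by
      rw [← inverseImage_comp, ← inverseImage_comp, prod.lift_fst, prod.lift_snd]
    rw [inverseImage_comp, inverseImage_comp, aux, h₁, ← aux]
  set i := incl S with hi
  have := mono_incl S
  let e := inverseImage (prod.map i i) d
  -- every element above `e` lies in the image of the diagonal of `S`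
  have hmem : ∀ v : (of S ⨯ of S : Locale.{u}), e ≤ v →
      ∃ s, localicMap (diag (of S)) s = v := fun v hv => by
    let c := incl (closedSublocale v)
    have hc : ∀ y, y ≤ v → inverseImage c y = ⊥ := fun y hy => by
      refine le_bot_iff.1 ((gc c).l_le (hy.trans ?_))
      exact (⊥ : closedSublocale v).2.trans_eq (localicMap_incl (closedSublocale v) ⊥).symm
    have h₁ : inverseImage (c ≫ prod.map i i) d = ⊥ := by
      rw [inverseImage_comp]
      exact hc _ hv
    have h₂ : c ≫ prod.fst = c ≫ prod.snd := by
      have := key _ h₁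
      simp only [Category.assoc, prod.map_fst, prod.map_snd] at this
      rwa [← Category.assoc, ← Category.assoc, cancel_mono] at this
    have h₃ : c = (c ≫ prod.fst) ≫ diag (of S) := by
      apply Limits.prod.hom_ext
      · rw [Category.assoc, prod.lift_fst, Category.comp_id]
      · rw [Category.assoc, prod.lift_snd, Category.comp_id, h₂]
    refine ⟨localicMap (c ≫ prod.fst) ⊥, ?_⟩
    rw [← localicMap_comp, ← h₃]
    refine le_antisymm ?_ ?_
    · refine (((gc c).monotone_u bot_le).trans_eq (localicMap_incl _ ⟨v, le_rfl⟩))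
    · exact (gc c).le_u (hc v le_rfl).le
  have he : inverseImage (diag (of S)) e = ⊥ := by
    change inverseImage (diag (of S)) (inverseImage (prod.map i i) d) = ⊥
    rw [← inverseImage_comp]
    have : diag (of S) ≫ prod.map i i = i ≫ diag L := by simp
    rw [this, inverseImage_comp, hdiag, map_bot]
  intro a
  refine ⟨localicMap (diag (of S)) a, Sublocale.ext fun v => ⟨?_, fun hv => ?_⟩⟩
  · rintro ⟨s, hs, rfl⟩
    exact (gc _).monotone_u hs
  · have hv : localicMap (diag (of S)) a ≤ v := hv
    obtain ⟨s, rfl⟩ := hmem v (((gc _).le_u (he ▸ bot_le)).trans hv)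
    refine ⟨s, ?_, rfl⟩
    change a ≤ s
    have hsurj : ∀ x, inverseImage (diag (of S)) (localicMap (diag (of S)) x) = x := fun x => by
      refine le_antisymm ((gc _).l_u_le x) ?_
      have hx : inverseImage (diag (of S)) (inverseImage prod.fst x) = x := by
        rw [← inverseImage_comp, prod.lift_fst, inverseImage_id]
      conv_lhs => rw [← hx]
      exact OrderHomClass.mono _ ((gc _).le_u hx.le)
    rw [← hsurj a, ← hsurj s]
    exact OrderHomClass.mono _ hv

theorem isCompactLocale_range {K L : Locale.{u}} (hK : IsCompactLocale K) (f : K ⟶ L) :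
    IsCompactLocale (of (range f)) := by
  have hr : ∀ y : L, ((range f).restrict y : L) = localicMap f (inverseImage f y) := fun y => by
    refine le_antisymm ?_ ?_
    · exact ((range f).giRestrict.gc.le_iff_le
        (b := ⟨localicMap f (inverseImage f y), mem_range.2 ⟨_, rfl⟩⟩)).2 ((gc f).le_u_l y)
    · obtain ⟨x, hx⟩ := mem_range.1 ((range f).restrict y).2
      rw [← hx]
      refine (gc f).monotone_u ((gc f).l_le ?_)
      rw [hx]
      exact (range f).giRestrict.gc.le_u_l y
  -- joins in `f(K)` are covers exactly when their inverse images in `K` are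
  have hcov : ∀ A : Set (range f), sSup A = ⊤ ↔
      sSup ((fun s : range f => inverseImage f (s : L)) '' A) = ⊤ := fun A => by
    have h₀ : sSup A = (range f).restrict (sSup (Subtype.val '' A)) := by
      conv_lhs => rw [← Set.image_id A]
      rw [map_sSup, Set.image_image]
      congr 1
      refine Set.image_congr fun s _ => ?_
      exact ((range f).restrict_of_mem s.2).symm
    have h₁ : sSup ((fun s : range f => inverseImage f (s : L)) '' A) =
        inverseImage f (sSup (Subtype.val '' A)) := by
      rw [map_sSup, Set.image_image]
    rw [h₀, h₁, Subtype.ext_iff, hr]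
    change localicMap f _ = ⊤ ↔ _
    constructor
    · intro h
      rw [← (gc f).l_u_l_eq_l, h, map_top]
    · intro h
      rw [h, (gc f).u_top]
  intro A hA
  obtain ⟨F, hFA, hF, hF'⟩ := hK _ ((hcov A).1 hA)
  obtain ⟨G, hGA, hG, rfl⟩ := Set.exists_subset_image_finite_and.1 ⟨F, hFA, hF, rfl⟩
  exact ⟨G, hGA, hG, (hcov G).2 hF'⟩

/-- The category `HLoc` of strongly Hausdorff locales, a full subcategory of `Locale`. -/
abbrev HLoc := IsStronglyHausdorff.{u}.FullSubcategory

/-! ## Compact sublocales and the slice `KHLoc/L` -/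

variable (L : HLoc.{u})

/-- The poset `𝒦(L)` of compact sublocales of `L`, ordered by inclusion. -/
abbrev CompactSublocale : Type u := {S : Sublocale L.obj // IsCompactLocale (of S)}

/-- The category `KHLoc/L`: the full subcategory of the over category `HLoc/L` on the arrows
`σ : K ⟶ L` with compact (strongly Hausdorff) domain `K`. -/
abbrev KHLocOver := ObjectProperty.FullSubcategory fun σ : Over L => IsCompactLocale σ.left.obj

/-- The functor `U_L : 𝒦(L) ⥤ KHLoc/L`, sending a compact sublocale `K` to its inclusion
`i_K : K ⟶ L` and `K ⊆ K'` to the inclusion `K ⟶ K'` over `L`. -/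
def inclusionFunctor : CompactSublocale L ⥤ KHLocOver L where
  obj K := ⟨Over.mk (Y := (⟨of K.1, isStronglyHausdorff_of_sublocale L.property K.1⟩ : HLoc.{u}))
    (ObjectProperty.homMk (incl K.1)), K.2⟩
  map {K K'} h := ObjectProperty.homMk <| Over.homMk
    (ObjectProperty.homMk (inclOfLE (leOfHom h)))
    (ObjectProperty.hom_ext _ (inclOfLE_incl (leOfHom h)))
  map_id K := by
    refine ObjectProperty.hom_ext _ (Over.OverMorphism.ext (ObjectProperty.hom_ext _ ?_))
    exact inclOfLE_refl K.1
  map_comp {K K' K''} h k := by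
    refine ObjectProperty.hom_ext _ (Over.OverMorphism.ext (ObjectProperty.hom_ext _ ?_))
    exact (inclOfLE_comp (leOfHom h) (leOfHom k)).symm

theorem range_comp_le {X Y Z : Locale.{u}} (f : X ⟶ Y) (g : Y ⟶ Z) :
    range (f ≫ g) ≤ range g := fun z hz => by
  obtain ⟨x, rfl⟩ := mem_range.1 hz
  exact mem_range.2 ⟨localicMap f x, (localicMap_comp f g x).symm⟩

/-- The functor `R_L : KHLoc/L ⥤ 𝒦(L)`, sending `σ : K ⟶ L` to the image `σ(K)`. -/
def imageFunctor : KHLocOver L ⥤ CompactSublocale L where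
  obj σ := ⟨range σ.obj.hom.hom, isCompactLocale_range σ.property _⟩
  map {σ τ} f := homOfLE <| by
    have h : f.hom.left.hom ≫ τ.obj.hom.hom = σ.obj.hom.hom :=
      congrArg InducedCategory.Hom.hom (Over.w f.hom)
    change range σ.obj.hom.hom ≤ range τ.obj.hom.hom
    rw [← h]
    exact range_comp_le _ _

end Locale

namespace Locale

/-! Compactness and the strong Hausdorff property are already spent on making `U_L` and `R_L` well
defined; what remains is the universal property of the image. A localic map `σ : K ⟶ L` factors
through a sublocale `S` exactly when `σ(K) ⊆ S` (`lift_incl` and `range_le_of_hom`), and the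
factorization is unique because `incl S` is mono. So the morphisms `σ ⟶ U_L S` form a set with at
most one element, inhabited precisely when `R_L σ ≤ S`, and this is the adjunction `R_L ⊣ U_L`. The
rest is formal. A right adjoint is final, since the unit at `σ` is initial in `σ/U_L`. Fullness
comes from `incl K` having image `K`, faithfulness from `𝒦(L)` being a poset, and final smallness
from `𝒦(L)` being a small category. -/

/-! ### Factoring a localic map through a sublocale containing its image -/

/-- The order of `S` is induced from `Y`, so the adjunction `f^* ⊣ f_*` restricts as soon as `f_*`
takes its values in `S`. -/
theorem gc_lift {X Y : Locale.{u}} (f : X ⟶ Y) (S : Sublocale Y) (h : range f ≤ S) :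
    GaloisConnection (fun s : S => inverseImage f (s : Y))
      (fun x : X => (⟨localicMap f x, h (mem_range.2 ⟨x, rfl⟩)⟩ : S)) :=
  fun s x => gc f (s : Y) x

/-- The frame homomorphism `S → X` induced by a morphism `f : X ⟶ Y` of locales whose image is
contained in the sublocale `S` of `Y`. -/
def liftHom {X Y : Locale.{u}} (f : X ⟶ Y) (S : Sublocale Y) (h : range f ≤ S) :
    FrameHom S X where
  toFun s := inverseImage f (s : Y)
  map_inf' a b := by rw [Sublocale.coe_inf, map_inf]
  map_top' := map_top (inverseImage f)
  -- Joins in `S` are not those of `Y`, so join preservation of `f^*` does not simply restrict; it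
  -- holds because the restricted map is again a left adjoint.
  map_sSup' _ := (gc_lift f S h).l_sSup.trans sSup_image.symm

/-- A morphism `f : X ⟶ Y` of locales factors through every sublocale of `Y` that contains
its image. -/
def lift {X Y : Locale.{u}} (f : X ⟶ Y) (S : Sublocale Y) (h : range f ≤ S) : X ⟶ of S :=
  homOfFrameHom (Y := of S) (liftHom f S h)

/-- Right adjoints are unique, so the factorization acts on points of the frame as `f_*` with its
codomain cut down to `S`. -/
theorem localicMap_lift {X Y : Locale.{u}} (f : X ⟶ Y) (S : Sublocale Y) (h : range f ≤ S)
    (x : X) : localicMap (lift f S h) x = (⟨localicMap f x, h (mem_range.2 ⟨x, rfl⟩)⟩ : S) :=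
  (gc (lift f S h)).u_unique (gc_lift f S h) (fun _ => rfl)

/-- Morphisms of locales are determined by their localic maps. -/
theorem hom_ext_localicMap {X Y : Locale.{u}} {f g : X ⟶ Y}
    (h : ∀ x, localicMap f x = localicMap g x) : f = g :=
  hom_ext' fun _ => (gc f).l_unique (gc g) h

/-- The comparison is made on right adjoints, where `incl S` is the plain subset inclusion; the
frame homomorphisms would involve the reflection of `Y` onto `S`. -/
theorem lift_incl {X Y : Locale.{u}} (f : X ⟶ Y) (S : Sublocale Y) (h : range f ≤ S) :
    lift f S h ≫ incl S = f :=
  hom_ext_localicMap fun x => (localicMap_comp _ _ x).trans <|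
    (congrArg _ (localicMap_lift f S h x)).trans (localicMap_incl S _)

/-! ### The reflection of `KHLoc/L` onto the compact sublocales -/

variable (L : HLoc.{u})

/-- There is at most one morphism over `L` into the inclusion of a compact sublocale. -/
theorem subsingleton_hom_inclusionFunctor (σ : KHLocOver L) (S : CompactSublocale L) :
    Subsingleton (σ ⟶ (inclusionFunctor L).obj S) := by
  refine ⟨fun f g => ObjectProperty.hom_ext _ (Over.OverMorphism.ext (ObjectProperty.hom_ext _ ?_))⟩
  have := mono_incl S.1
  have hf : f.hom.left.hom ≫ incl S.1 = σ.obj.hom.hom :=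
    congrArg InducedCategory.Hom.hom (Over.w f.hom)
  have hg : g.hom.left.hom ≫ incl S.1 = σ.obj.hom.hom :=
    congrArg InducedCategory.Hom.hom (Over.w g.hom)
  exact (cancel_mono (incl S.1)).1 (hf.trans hg.symm)

/-- Functoriality of the image turns a morphism over `L` into `σ(K) ⊆ i_S(S)`, and `i_S(S)` is `S`
itself. -/
theorem range_le_of_hom {σ : KHLocOver L} {S : CompactSublocale L}
    (f : σ ⟶ (inclusionFunctor L).obj S) : range σ.obj.hom.hom ≤ S.1 :=
  (leOfHom ((imageFunctor L).map f)).trans (range_incl S.1).le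

/-- The reflection of `KHLoc/L` onto `𝒦(L)`. -/
def imageAdjunction : imageFunctor L ⊣ inclusionFunctor L :=
  Adjunction.mkOfHomEquiv
    { homEquiv := fun σ S =>
        -- A morphism `h` out of `R_L σ` is the inclusion `σ(K) ⊆ S`, which is exactly what
        -- factoring `σ` through `S` requires. The inverse and naturality laws then hold because
        -- both hom-sets have at most one element.
        { toFun := fun h => ObjectProperty.homMk <| Over.homMk
            (ObjectProperty.homMk (lift σ.obj.hom.hom S.1 (leOfHom h)))
            (ObjectProperty.hom_ext _ (lift_incl σ.obj.hom.hom S.1 (leOfHom h)))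
          invFun := fun f => homOfLE (range_le_of_hom L f)
          left_inv := fun _ => Subsingleton.elim _ _
          right_inv := fun _ => (subsingleton_hom_inclusionFunctor L σ S).elim _ _ }
      homEquiv_naturality_left_symm := fun _ _ => Subsingleton.elim _ _
      homEquiv_naturality_right := fun _ _ =>
        (subsingleton_hom_inclusionFunctor L _ _).elim _ _ }

end Locale

theorem mainTheorem6 (L : Locale.HLoc.{u}) :
    (Locale.inclusionFunctor L).Full ∧ (Locale.inclusionFunctor L).Faithful ∧
      Nonempty (Locale.imageFunctor L ⊣ Locale.inclusionFunctor L) ∧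
      (Locale.inclusionFunctor L).Final ∧
      FinallySmall.{u} (Locale.KHLocOver L) := by
  -- Each `σ/U_L` is connected because it has an initial object, the unit `σ ⟶ U_L (R_L σ)`.
  have hfinal := Functor.final_of_adjunction (Locale.imageAdjunction L)
  refine ⟨⟨fun {K K'} f => ?_⟩, ⟨fun _ => Subsingleton.elim _ _⟩, ⟨Locale.imageAdjunction L⟩,
    hfinal, FinallySmall.mk' (Locale.inclusionFunctor L)⟩
  -- A morphism `i_K ⟶ i_K'` over `L` forces `K = i_K(K) ⊆ K'`; uniqueness of factorizations
  -- identifies it with the image of that inclusion.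
  exact ⟨homOfLE ((Locale.range_incl K.1).ge.trans (Locale.range_le_of_hom L f)),
    (Locale.subsingleton_hom_inclusionFunctor L _ K').elim _ _⟩
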